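/- Let $G$ be an infinite group with a finite symmetric generating set $S$, and let $p>1$ be a real number. For $f\colon G\to\mathbb C$ put $\|f\|=\bigl(\sum_{s\in S}\sum_{g\in G}|f(gs^{-1})-f(g)|^p\bigr)^{1/p}$. Let $D_p(G)$ be the space of all $f$ with $\|f\|<\infty$, with the norm $\|f\|_{D_p}=(\|f\|^p+|f(e)|^p)^{1/p}$, and let $BD_p(G)$ be the algebra (under pointwise operations) of bounded functions in $D_p(G)$. Let $Sp(BD_p(G))$ be the set of characters (nonzero algebra homomorphisms $BD_p(G)\to\mathbb C$) with the weak-$*$ topology, i.e. the topology of pointwise convergence on $BD_p(G)$; for $f\in BD_p(G)$ let $\hat f(\tau)=\tau(f)$ be its Gelfand transform. Identify $g\in G$ with the character $f\mapsto f(g)$. The $p$-harmonic boundary $\partial_p(G)$ is the set, with the subspace topology, of all $x\in Sp(BD_p(G))\setminus G$ such that $\hat f(x)=0$ for every bounded $f$ in the $\|\cdot\|_{D_p}$-closure in $D_p(G)$ of the finitely supported functions. Put $\triangle_p f(g)=\sum_{s\in S}|f(gs^{-1})-f(g)|^{p-2}(f(gs^{-1})-f(g))$, where a summand with $f(gs^{-1})=f(g)$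 is $0$. For $A\subseteq G$ let $\partial A=\{g\in G\setminus A : gs^{-1}\in A\text{ for some }s\in S\}$. An infinite set $A\subseteq G$ that is connected in the Cayley graph of $(G,S)$ (where $g_1,g_2$ are joined if and only if $g_1=g_2s^{\pm1}$ for some $s\in S$) and has $\partial A\neq\emptyset$ is called $D_p$-massive if there is a nonnegative $u\in BD_p(G)$ with $\triangle_p u(a)=0$ for all $a\in A$, $u=0$ on $\partial A$, and $\sup_{a\in A}u(a)=1$; every such $u$ is called an inner potential of $A$. For a $D_p$-massive $A$ and an inner potential $u$ of $A$ with $u=0$ on $G\setminus A$, let $\hat A_u=\{\tau\in Sp(BD_p(G)) : \hat u(\tau)>0\}$. Then the family $\mathcal B$ of all sets $\hat A_u\cap\partial_p(G)$, for all such pairs $(A,u)$, is a base for the topology of $\partial_p(G)$. -/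

import Mathlib

open scoped ComplexOrder

namespace PHarmonic

variable {G : Type*} [Group G]

/-- `D_p(G)`: the functions `f : G → ℂ` with `∑_g |f(g s⁻¹) - f(g)|^p < ∞` for every `s ∈ S`. -/
def Dp (S : Finset G) (p : ℝ) : Set (G → ℂ) :=
  {f | ∀ s ∈ S, Summable fun g : G => ‖f (g * s⁻¹) - f g‖ ^ p}

/-- The pseudonorm `‖f‖ = (∑_{s ∈ S} ∑_g |f(g s⁻¹) - f(g)|^p)^{1/p}` on `D_p(G)`. -/
noncomputable def dpSeminorm (S : Finset G) (p : ℝ) (f : G → ℂ) : ℝ :=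
  (∑ s ∈ S, ∑' g : G, ‖f (g * s⁻¹) - f g‖ ^ p) ^ (1 / p)

/-- The norm `‖f‖_{D_p} = (‖f‖^p + |f(e)|^p)^{1/p}` on `D_p(G)`. -/
noncomputable def dpNorm (S : Finset G) (p : ℝ) (f : G → ℂ) : ℝ :=
  (dpSeminorm S p f ^ p + ‖f 1‖ ^ p) ^ (1 / p)

/-- The closure of the finitely supported functions `ℂG` in `D_p(G)` for `‖·‖_{D_p}`. -/
def closureFinsupp (S : Finset G) (p : ℝ) : Set (G → ℂ) :=
  {f | f ∈ Dp S p ∧ ∀ ε : ℝ, 0 < ε →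
    ∃ k : G → ℂ, (Function.support k).Finite ∧ dpNorm S p (f - k) < ε}

theorem add_rpow_le {p a b : ℝ} (hp : 1 ≤ p) (ha : 0 ≤ a) (hb : 0 ≤ b) :
    (a + b) ^ p ≤ 2 ^ p * (a ^ p + b ^ p) := by
  have hp0 : 0 ≤ p := by linarith
  have h1 : (a + b) ^ p ≤ (2 * max a b) ^ p := by
    apply Real.rpow_le_rpow (by positivity) _ hp0
    linarith [le_max_left a b, le_max_right a b]
  have h2 : (max a b) ^ p ≤ a ^ p + b ^ p := by
    have := Real.rpow_nonneg ha p
    have := Real.rpow_nonneg hb p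
    rcases max_choice a b with h | h <;> rw [h] <;> linarith
  rw [Real.mul_rpow (by norm_num) (le_max_of_le_left ha)] at h1
  exact h1.trans (mul_le_mul_of_nonneg_left h2 (by positivity))

/-- `BD_p(G)`: the algebra, under pointwise operations, of the bounded functions in `D_p(G)`. -/
def BDp (S : Finset G) (p : ℝ) (hp : 1 ≤ p) : Subalgebra ℂ (G → ℂ) where
  carrier := {f | f ∈ Dp S p ∧ ∃ C : ℝ, ∀ g, ‖f g‖ ≤ C}
  algebraMap_mem' c := by
    refine ⟨fun s _ => ?_, ‖c‖, fun g => le_of_eq (by simp [Pi.algebraMap_apply])⟩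
    have hp0 : p ≠ 0 := by linarith
    simp [Pi.algebraMap_apply, Real.zero_rpow hp0]
  add_mem' := by
    rintro f k ⟨hf, C, hC⟩ ⟨hk, D, hD⟩
    refine ⟨fun s hs => ?_, C + D, fun g => (norm_add_le _ _).trans (add_le_add (hC g) (hD g))⟩
    refine Summable.of_nonneg_of_le (fun g => by positivity) (fun g => ?_)
      (((hf s hs).add (hk s hs)).mul_left (2 ^ p))
    refine le_trans (Real.rpow_le_rpow (norm_nonneg _) ?_ (by linarith))
      (add_rpow_le hp (norm_nonneg _) (norm_nonneg _))
    have : (f + k) (g * s⁻¹) - (f + k) g = (f (g * s⁻¹) - f g) + (k (g * s⁻¹) - k g) := by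
      simp only [Pi.add_apply]; ring
    rw [this]
    exact norm_add_le _ _
  mul_mem' := by
    rintro f k ⟨hf, C, hC⟩ ⟨hk, D, hD⟩
    have hC0 : 0 ≤ C := (norm_nonneg _).trans (hC 1)
    have hD0 : 0 ≤ D := (norm_nonneg _).trans (hD 1)
    refine ⟨fun s hs => ?_, C * D, fun g => by
      rw [Pi.mul_apply, norm_mul]
      exact mul_le_mul (hC g) (hD g) (norm_nonneg _) hC0⟩
    refine Summable.of_nonneg_of_le (fun g => by positivity) (fun g => ?_)
      ((((hf s hs).mul_left (D ^ p)).add ((hk s hs).mul_left (C ^ p))).mul_left (2 ^ p))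
    rw [← Real.mul_rpow hD0 (norm_nonneg _), ← Real.mul_rpow hC0 (norm_nonneg _)]
    refine le_trans (Real.rpow_le_rpow (norm_nonneg _) ?_ (by linarith))
      (add_rpow_le hp (by positivity) (by positivity))
    have : (f * k) (g * s⁻¹) - (f * k) g
        = k (g * s⁻¹) * (f (g * s⁻¹) - f g) + f g * (k (g * s⁻¹) - k g) := by
      simp only [Pi.mul_apply]; ring
    rw [this]
    refine (norm_add_le _ _).trans ?_
    rw [norm_mul, norm_mul]
    exact add_le_add (mul_le_mul_of_nonneg_right (hD _) (norm_nonneg _))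
      (mul_le_mul_of_nonneg_right (hC _) (norm_nonneg _))

/-- `Sp(BD_p(G))`: the characters of `BD_p(G)`. A nonzero multiplicative linear functional on a
unital algebra is the same as a unital algebra homomorphism. -/
def Sp (S : Finset G) (p : ℝ) (hp : 1 ≤ p) : Type _ := BDp S p hp →ₐ[ℂ] ℂ

/-- The Gelfand transform: `f̂(τ) = τ(f)`. -/
noncomputable def gelfand {S : Finset G} {p : ℝ} {hp : 1 ≤ p} (f : BDp S p hp) (τ : Sp S p hp) : ℂ :=
  DFunLike.coe (F := BDp S p hp →ₐ[ℂ] ℂ) τ f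

/-- The weak-* topology on the spectrum: pointwise convergence on `BD_p(G)`. -/
noncomputable instance instTopologicalSpaceSp (S : Finset G) (p : ℝ) (hp : 1 ≤ p) : TopologicalSpace (Sp S p hp) :=
  TopologicalSpace.induced (fun τ (f : BDp S p hp) => gelfand f τ) inferInstance

/-- The map `i : G → Sp(BD_p(G))`, `i(g)(f) = f(g)`. -/
noncomputable def incl (S : Finset G) (p : ℝ) (hp : 1 ≤ p) (g : G) : Sp S p hp :=
  (Pi.evalAlgHom ℂ (fun _ : G => ℂ) g).comp (BDp S p hp).val

/-- The `p`-Royden boundary `Sp(BD_p(G)) \ G`. -/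
def roydenBoundary (S : Finset G) (p : ℝ) (hp : 1 ≤ p) : Set (Sp S p hp) :=
  (Set.range (incl S p hp))ᶜ

/-- The `p`-harmonic boundary `∂_p(G)`: the points of the `p`-Royden boundary at which the Gelfand
transform of every bounded function in the `D_p`-closure of `ℂG` vanishes. -/
def harmonicBoundary (S : Finset G) (p : ℝ) (hp : 1 ≤ p) : Set (Sp S p hp) :=
  {x | x ∈ roydenBoundary S p hp ∧
    ∀ f : BDp S p hp, (f : G → ℂ) ∈ closureFinsupp S p → gelfand f x = 0}

/-- The `p`-Laplacian. If `f(g s⁻¹) = f(g)` the corresponding summand is `0`, whatever the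
value of the real power. -/
noncomputable def pLaplacian (S : Finset G) (p : ℝ) (f : G → ℂ) (g : G) : ℂ :=
  ∑ s ∈ S, ((‖f (g * s⁻¹) - f g‖ ^ (p - 2) : ℝ) : ℂ) * (f (g * s⁻¹) - f g)

/-- `∂A`: the `g ∉ A` with `g s⁻¹ ∈ A` for some `s ∈ S`. -/
def outerBoundary (S : Finset G) (A : Set G) : Set G :=
  {g | g ∉ A ∧ ∃ s ∈ S, g * s⁻¹ ∈ A}

/-- `u ∈ BD_p(G)` is an inner potential of `A`. The order on `ℂ` is the one for which `0 ≤ z` says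
that `z` is real and nonnegative. -/
structure IsInnerPotential {S : Finset G} {p : ℝ} {hp : 1 ≤ p} (A : Set G)
    (u : BDp S p hp) : Prop where
  nonneg : ∀ g : G, 0 ≤ (u : G → ℂ) g
  harmonic : ∀ a ∈ A, pLaplacian S p (u : G → ℂ) a = 0
  boundary : ∀ g ∈ outerBoundary S A, (u : G → ℂ) g = 0
  sup_eq : IsLUB ((fun a => ((u : G → ℂ) a).re) '' A) 1

/-- `A` is a `D_p`-massive subset of `G`: infinite, connected in the Cayley graph (where `g₁ ≠ g₂`
are joined iff `g₁ = g₂ s^{±1}` for some `s ∈ S`), with `∂A ≠ ∅`, and with an inner potential. -/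
structure IsMassive (S : Finset G) (p : ℝ) (hp : 1 ≤ p) (A : Set G) : Prop where
  infinite : A.Infinite
  connected : ((SimpleGraph.mulCayley (S : Set G)).induce A).Connected
  boundary : (outerBoundary S A).Nonempty
  potential : ∃ u : BDp S p hp, IsInnerPotential A u

/-- `Â_u`: the characters at which the Gelfand transform of `u` is (real and) positive. -/
def positiveSet {S : Finset G} {p : ℝ} {hp : 1 ≤ p} (u : BDp S p hp) : Set (Sp S p hp) :=
  {τ | 0 < gelfand u τ}

/-- The family `ℬ` of the sets `Â_u ∩ ∂_p(G)`, as subsets of the space `∂_p(G)`; here `A` is a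
`D_p`-massive subset of `G` and `u` an inner potential of `A` that vanishes off `A`. -/
def massiveFamily (S : Finset G) (p : ℝ) (hp : 1 ≤ p) : Set (Set (harmonicBoundary S p hp)) :=
  {V | ∃ (A : Set G) (u : BDp S p hp), IsMassive S p hp A ∧ IsInnerPotential A u ∧
    (∀ g, g ∉ A → (u : G → ℂ) g = 0) ∧ V = Subtype.val ⁻¹' positiveSet u}

end PHarmonic

namespace PHarmonic

open Filter Topology

variable {G : Type*} [Group G] {S : Finset G} {p : ℝ}

/-! ### The algebra `BD_p(G)` -/

/-! For `u ≥ 0` the transform of `u` is nonnegative, so the set where it is positive is the set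
where it is nonzero, which is open. It remains to fit a member of the family into a given
neighbourhood `U` of a point `x` of `∂_p(G)`.

`BD_p(G)` has a bump `b ≥ 0` whose transform is positive at `x` and only at points of `U`
(`exists_bump`). Removing the identity leaves finitely many components of the Cayley graph. Since
`x` kills finitely supported functions, the indicator of some infinite component `C` takes the value
`1` at `x` (`exists_component_of_mem_harmonicBoundary`).

Put `f = b · 1_C` and minimize the `p`-energy over finite perturbations of `f` that vanish off `C`.
Uniform convexity makes a minimizing sequence Cauchy in energy. Its limit `u` is `p`-harmonic on
`C`, and `u - f` is a limit of finitely supported functions, so `u` and `f` have the same transform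
on `∂_p(G)` (`exists_dirichlet_solution`, `exists_pHarmonic_extension`). Divided by its supremum,
`u` is an inner potential of `C`, and on `∂_p(G)` its transform is positive only where that of `b`
is, hence inside `U`. -/

/-- This is the functional calculus of `BD_p(G)`: it yields conjugates, Lipschitz functions of the
real part, and inverses of functions bounded away from `0`. -/
theorem mem_BDp_of_lipschitz (hp : 1 ≤ p) {f k : G → ℂ} (hk : k ∈ BDp S p hp) {C D : ℝ}
    (hC : 0 ≤ C) (hD : ∀ g, ‖f g‖ ≤ D) (h : ∀ a b, ‖f a - f b‖ ≤ C * ‖k a - k b‖) :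
    f ∈ BDp S p hp := by
  refine ⟨fun s hs => ?_, D, hD⟩
  refine Summable.of_nonneg_of_le (fun g => by positivity) (fun g => ?_)
    ((hk.1 s hs).mul_left (C ^ p))
  rw [← Real.mul_rpow hC (norm_nonneg _)]
  exact Real.rpow_le_rpow (norm_nonneg _) (h _ _) (by linarith)

theorem mem_BDp_of_finite (hp : 1 ≤ p) {f : G → ℂ} {D : ℝ} (hD : ∀ g, ‖f g‖ ≤ D)
    (h : ∀ s ∈ S, {g | f (g * s⁻¹) ≠ f g}.Finite) : f ∈ BDp S p hp := by
  refine ⟨fun s hs => summable_of_hasFiniteSupport ((h s hs).subset fun g hg => ?_), D, hD⟩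
  intro h0
  apply hg
  simp [h0, Real.zero_rpow (by linarith : p ≠ 0)]

theorem star_mem_BDp {hp : 1 ≤ p} {f : G → ℂ} (hf : f ∈ BDp S p hp) : star f ∈ BDp S p hp := by
  obtain ⟨C, hC⟩ := hf.2
  refine mem_BDp_of_lipschitz hp hf (C := 1) (D := C) zero_le_one (fun g => by simpa using hC g) ?_
  intro a b
  rw [one_mul, Pi.star_apply, Pi.star_apply, ← star_sub, norm_star]

theorem ofReal_comp_mem_BDp {hp : 1 ≤ p} {f : G → ℂ} (hf : f ∈ BDp S p hp) {φ : ℝ → ℝ}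
    (hφ : ∀ x y, |φ x - φ y| ≤ |x - y|) : (fun g => (φ (f g).re : ℂ)) ∈ BDp S p hp := by
  obtain ⟨C, hC⟩ := hf.2
  refine mem_BDp_of_lipschitz hp hf (C := 1) (D := |φ 0| + C) zero_le_one (fun g => ?_) ?_
  · rw [Complex.norm_real, Real.norm_eq_abs]
    have h1 := hφ (f g).re 0
    have h2 := (Complex.abs_re_le_norm (f g)).trans (hC g)
    rw [sub_zero] at h1
    have := abs_sub_abs_le_abs_sub (φ (f g).re) (φ 0)
    linarith
  · intro a b
    rw [← Complex.ofReal_sub, Complex.norm_real, Real.norm_eq_abs, one_mul]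
    refine (hφ _ _).trans ?_
    rw [← Complex.sub_re]
    exact Complex.abs_re_le_norm _

theorem inv_mem_BDp {hp : 1 ≤ p} {f : G → ℂ} (hf : f ∈ BDp S p hp) {c : ℝ} (hc : 0 < c)
    (h : ∀ g, c ≤ ‖f g‖) : f⁻¹ ∈ BDp S p hp := by
  refine mem_BDp_of_lipschitz hp hf (C := (c * c)⁻¹) (D := c⁻¹) (by positivity) (fun g => ?_) ?_
  · rw [Pi.inv_apply, norm_inv]
    exact inv_anti₀ hc (h g)
  · intro a b
    have ha : 0 < ‖f a‖ := hc.trans_le (h a)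
    have hb : 0 < ‖f b‖ := hc.trans_le (h b)
    rw [Pi.inv_apply, Pi.inv_apply, inv_sub_inv (norm_pos_iff.1 ha) (norm_pos_iff.1 hb), norm_div,
      norm_mul, norm_sub_rev, div_eq_inv_mul]
    refine mul_le_mul_of_nonneg_right (inv_anti₀ (by positivity) ?_) (norm_nonneg _)
    exact mul_le_mul (h a) (h b) hc.le (norm_nonneg _)

/-! ### Characters -/

section Characters

variable {hp : 1 ≤ p} (τ : Sp S p hp) (f k : BDp S p hp)

theorem gelfand_add : gelfand (f + k) τ = gelfand f τ + gelfand k τ :=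
  map_add (F := BDp S p hp →ₐ[ℂ] ℂ) τ f k

theorem gelfand_sub : gelfand (f - k) τ = gelfand f τ - gelfand k τ :=
  map_sub (F := BDp S p hp →ₐ[ℂ] ℂ) τ f k

theorem gelfand_mul : gelfand (f * k) τ = gelfand f τ * gelfand k τ :=
  map_mul (F := BDp S p hp →ₐ[ℂ] ℂ) τ f k

theorem gelfand_smul (c : ℂ) : gelfand (c • f) τ = c * gelfand f τ :=
  map_smul (F := BDp S p hp →ₐ[ℂ] ℂ) τ c f

theorem gelfand_zero : gelfand (0 : BDp S p hp) τ = 0 :=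
  map_zero (F := BDp S p hp →ₐ[ℂ] ℂ) τ

theorem gelfand_one : gelfand (1 : BDp S p hp) τ = 1 :=
  map_one (F := BDp S p hp →ₐ[ℂ] ℂ) τ

theorem gelfand_algebraMap (c : ℂ) : gelfand (algebraMap ℂ (BDp S p hp) c) τ = c :=
  AlgHom.commutes (show BDp S p hp →ₐ[ℂ] ℂ from τ) c

theorem gelfand_prod {ι : Type*} (s : Finset ι) (F : ι → BDp S p hp) :
    gelfand (∏ i ∈ s, F i) τ = ∏ i ∈ s, gelfand (F i) τ :=
  map_prod (show BDp S p hp →ₐ[ℂ] ℂ from τ) F s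

/-- `τ(f)` lies in the closure of the range of `f`. -/
theorem gelfand_mem_closure_range : gelfand f τ ∈ closure (Set.range (f : G → ℂ)) := by
  rw [Metric.mem_closure_range_iff]
  by_contra! h
  obtain ⟨c, hc, h⟩ := h
  set l := gelfand f τ
  set k : BDp S p hp := f - algebraMap ℂ _ l with hk
  have hk0 : ∀ g, c ≤ ‖(k : G → ℂ) g‖ := fun g => by
    have := h g
    rwa [dist_comm, dist_eq_norm] at this
  -- `f - l` stays away from `0`, so it is invertible in `BD_p(G)`; yet `τ` kills it.
  have h1 : k * ⟨_, inv_mem_BDp k.2 hc hk0⟩ = 1 := by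
    ext g
    exact mul_inv_cancel₀ (norm_pos_iff.1 (hc.trans_le (hk0 g)))
  have h2 := congrArg (fun f => gelfand f τ) h1
  simp only [gelfand_mul, gelfand_one, hk, gelfand_sub, gelfand_algebraMap] at h2
  simp [l] at h2

variable {f}

theorem gelfand_nonneg (h : ∀ g, 0 ≤ (f : G → ℂ) g) : 0 ≤ gelfand f τ := by
  refine closure_minimal ?_ (isClosed_Ici (a := (0 : ℂ))) (gelfand_mem_closure_range τ f)
  rintro _ ⟨g, rfl⟩
  exact h g

theorem gelfand_im_eq_zero (h : ∀ g, ((f : G → ℂ) g).im = 0) : (gelfand f τ).im = 0 := by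
  refine closure_minimal (t := {z : ℂ | z.im = 0}) ?_
    (isClosed_eq Complex.continuous_im continuous_const) (gelfand_mem_closure_range τ f)
  rintro _ ⟨g, rfl⟩
  exact h g

variable (f)

/-- Both `f + f̄` and `i (f - f̄)` are real valued, hence have real transforms. -/
theorem gelfand_star : gelfand ⟨_, star_mem_BDp f.2⟩ τ = star (gelfand f τ) := by
  set k : BDp S p hp := ⟨_, star_mem_BDp f.2⟩ with hk
  have hkg : ∀ g, (k : G → ℂ) g = star ((f : G → ℂ) g) := fun g => rfl
  have h1 := gelfand_im_eq_zero (f := f + k) τ fun g => by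
    change ((f : G → ℂ) g + (k : G → ℂ) g).im = 0
    simp [hkg]
  have h2 := gelfand_im_eq_zero (f := Complex.I • (f - k)) τ fun g => by
    change (Complex.I * ((f : G → ℂ) g - (k : G → ℂ) g)).im = 0
    simp [hkg]
  rw [gelfand_add] at h1
  rw [gelfand_smul, gelfand_sub] at h2
  simp at h1 h2
  apply Complex.ext
  · simp; linarith
  · simp; linarith

end Characters

/-! ### Bump functions on the spectrum -/

/-- With `F = |h - ĥ(x)|²`, take the positive and negative parts `b`, `d` of `ε² - F`. The
identities `b d = 0` and `b - d = ε² - F` are algebraic, so they survive under every character: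
where `b̂ > 0`, necessarily `d̂ = 0` and `F̂ < ε²`. -/
theorem exists_bump_ball {hp : 1 ≤ p} (x : Sp S p hp) (h : BDp S p hp) {ε : ℝ} (hε : 0 < ε) :
    ∃ f : BDp S p hp, (∀ g, 0 ≤ (f : G → ℂ) g) ∧ 0 < gelfand f x ∧
      ∀ τ, 0 < gelfand f τ → ‖gelfand h τ - gelfand h x‖ < ε := by
  set k : BDp S p hp := h - algebraMap ℂ _ (gelfand h x) with hk
  set F : BDp S p hp := k * ⟨_, star_mem_BDp k.2⟩ with hF
  have hFg : ∀ g, (F : G → ℂ) g = ((‖(k : G → ℂ) g‖ ^ 2 : ℝ) : ℂ) := fun g => by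
    change (k : G → ℂ) g * star ((k : G → ℂ) g) = _
    rw [Complex.star_def, Complex.mul_conj, Complex.normSq_eq_norm_sq]
  have hFτ : ∀ τ, gelfand F τ = ((‖gelfand h τ - gelfand h x‖ ^ 2 : ℝ) : ℂ) := fun τ => by
    rw [hF, gelfand_mul, gelfand_star, Complex.star_def, Complex.mul_conj,
      Complex.normSq_eq_norm_sq, hk, gelfand_sub, gelfand_algebraMap]
  set b : BDp S p hp := ⟨_, ofReal_comp_mem_BDp F.2 (φ := fun y => max (ε ^ 2 - y) 0) fun y z => by
    refine (abs_max_sub_max_le_abs _ _ _).trans (le_of_eq ?_)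
    rw [abs_sub_comm]; congr 1; ring⟩ with hb
  set d : BDp S p hp := ⟨_, ofReal_comp_mem_BDp F.2 (φ := fun y => max (y - ε ^ 2) 0) fun y z => by
    refine (abs_max_sub_max_le_abs _ _ _).trans (le_of_eq ?_)
    congr 1; ring⟩ with hd
  have hb0 : ∀ g, 0 ≤ (b : G → ℂ) g := fun g => by
    simp only [hb]; exact_mod_cast le_max_right _ _
  have hd0 : ∀ g, 0 ≤ (d : G → ℂ) g := fun g => by
    simp only [hd]; exact_mod_cast le_max_right _ _
  have hbd : b * d = 0 := by
    ext g
    change (b : G → ℂ) g * (d : G → ℂ) g = 0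
    simp only [hb, hd, mul_eq_zero, Complex.ofReal_eq_zero]
    rcases le_total (((F : G → ℂ) g).re) (ε ^ 2) with h1 | h1
    · right; exact max_eq_right (by linarith)
    · left; exact max_eq_right (by linarith)
  have hsub : b - d = algebraMap ℂ _ ((ε ^ 2 : ℝ) : ℂ) - F := by
    ext g
    change (b : G → ℂ) g - (d : G → ℂ) g = ((ε ^ 2 : ℝ) : ℂ) - (F : G → ℂ) g
    simp only [hb, hd, hFg, Complex.ofReal_re]
    rw [← Complex.ofReal_sub, ← Complex.ofReal_sub]
    congr 1
    rcases le_total (‖(k : G → ℂ) g‖ ^ 2) (ε ^ 2) with h1 | h1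
    · rw [max_eq_left (by linarith), max_eq_right (by linarith)]; ring
    · rw [max_eq_right (by linarith), max_eq_left (by linarith)]; ring
  have hsub' : ∀ τ, gelfand b τ - gelfand d τ
      = ((ε ^ 2 - ‖gelfand h τ - gelfand h x‖ ^ 2 : ℝ) : ℂ) := fun τ => by
    rw [← gelfand_sub, hsub, gelfand_sub, gelfand_algebraMap, hFτ, Complex.ofReal_sub]
  refine ⟨b, hb0, ?_, fun τ hτ => ?_⟩
  · have h1 := hsub' x
    rw [sub_eq_iff_eq_add] at h1
    rw [h1]
    refine add_pos_of_pos_of_nonneg ?_ (gelfand_nonneg x hd0)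
    rw [Complex.zero_lt_real]
    simpa using by positivity
  · have h1 := congrArg (fun f => gelfand f τ) hbd
    simp only [gelfand_mul, gelfand_zero, mul_eq_zero] at h1
    have h2 := hsub' τ
    rw [h1.resolve_left hτ.ne', sub_zero] at h2
    rw [h2, Complex.zero_lt_real, sub_pos] at hτ
    exact lt_of_pow_lt_pow_left₀ 2 hε.le hτ

/-- A weak-* neighbourhood restricts only finitely many transforms; the product of the corresponding
ball bumps works. -/
theorem exists_bump {hp : 1 ≤ p} {x : Sp S p hp} {U : Set (Sp S p hp)} (hU : U ∈ 𝓝 x) :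
    ∃ f : BDp S p hp, (∀ g, 0 ≤ (f : G → ℂ) g) ∧ 0 < gelfand f x ∧
      ∀ τ, 0 < gelfand f τ → τ ∈ U := by
  rw [nhds_induced, mem_comap] at hU
  obtain ⟨V, hV, hVU⟩ := hU
  rw [nhds_pi, Filter.mem_pi] at hV
  obtain ⟨I, hI, t, ht, htV⟩ := hV
  have key : ∀ h : BDp S p hp, ∃ f : BDp S p hp, (∀ g, 0 ≤ (f : G → ℂ) g) ∧ 0 < gelfand f x ∧
      ∀ τ, 0 < gelfand f τ → gelfand h τ ∈ t h := fun h => by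
    obtain ⟨ε, hε, hb⟩ := Metric.mem_nhds_iff.1 (ht h)
    obtain ⟨f, hf, hfx, hfτ⟩ := exists_bump_ball x h hε
    exact ⟨f, hf, hfx, fun τ hτ => hb (by simpa [dist_eq_norm] using hfτ τ hτ)⟩
  choose F hF hFx hFτ using key
  refine ⟨∏ h ∈ hI.toFinset, F h, fun g => ?_, ?_, fun τ hτ => hVU (htV fun h hh => ?_)⟩
  · have : ((∏ h ∈ hI.toFinset, F h : BDp S p hp) : G → ℂ) g
        = ∏ h ∈ hI.toFinset, (F h : G → ℂ) g := by
      rw [← Finset.prod_apply]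
      exact congrFun (map_prod (BDp S p hp).val F _) g
    rw [this]
    exact Finset.prod_nonneg fun h _ => hF h g
  · rw [gelfand_prod]
    exact Finset.prod_pos fun h _ => hFx h
  · apply hFτ
    rw [gelfand_prod] at hτ
    exact lt_of_le_of_ne (gelfand_nonneg τ (hF h))
      (Finset.prod_ne_zero_iff.1 hτ.ne' h (hI.mem_toFinset.2 hh)).symm

theorem continuous_gelfand {hp : 1 ≤ p} (f : BDp S p hp) : Continuous (gelfand f) :=
  (continuous_apply f).comp continuous_induced_dom

theorem isOpen_positiveSet {hp : 1 ≤ p} {u : BDp S p hp} (hu : ∀ g, 0 ≤ (u : G → ℂ) g) :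
    IsOpen (positiveSet u) := by
  have : positiveSet u = gelfand u ⁻¹' {0}ᶜ := by
    ext τ
    exact ⟨fun h => h.ne', fun h => lt_of_le_of_ne (gelfand_nonneg τ hu) (Ne.symm h)⟩
  rw [this]
  exact isOpen_compl_singleton.preimage (continuous_gelfand u)

/-! ### Components of the complement of the identity -/

/-- The Cayley graph of `(G, S)` without the edges at the identity. -/
def puncturedCayley (S : Finset G) : SimpleGraph G where
  Adj a b := (SimpleGraph.mulCayley (S : Set G)).Adj a b ∧ a ≠ 1 ∧ b ≠ 1
  symm := ⟨fun _ _ h => ⟨h.1.symm, h.2.2, h.2.1⟩⟩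
  loopless := ⟨fun _ h => h.1.ne rfl⟩

/-- The component of `s` in the Cayley graph without the edges at the identity. -/
def component (S : Finset G) (s : G) : Set G :=
  ((puncturedCayley S).connectedComponentMk s).supp

theorem puncturedCayley_le (S : Finset G) :
    puncturedCayley S ≤ SimpleGraph.mulCayley (S : Set G) :=
  SimpleGraph.le_iff_adj.2 fun _ _ h => h.1

theorem mem_component {s g : G} : g ∈ component S s ↔ (puncturedCayley S).Reachable g s := by
  rw [component, SimpleGraph.ConnectedComponent.mem_supp_iff, SimpleGraph.ConnectedComponent.eq]

theorem induce_component_connected (s : G) :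
    ((SimpleGraph.mulCayley (S : Set G)).induce (component S s)).Connected :=
  (SimpleGraph.ConnectedComponent.connected_toSimpleGraph
    ((puncturedCayley S).connectedComponentMk s)).mono
    (SimpleGraph.comap_monotone _ (puncturedCayley_le S))

theorem one_notMem_component {s : G} (hs : s ≠ 1) : (1 : G) ∉ component S s := by
  rw [mem_component]
  rintro ⟨w⟩
  cases w with
  | nil => exact hs rfl
  | cons h _ => exact h.2.1 rfl

theorem mul_inv_mem_component {s t g : G} (ht : t ∈ S) (hg : g ≠ 1) (hgt : g * t⁻¹ ≠ 1) :
    g * t⁻¹ ∈ component S s ↔ g ∈ component S s := by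
  rw [mem_component, mem_component]
  by_cases h : g * t⁻¹ = g
  · rw [h]
  have hadj : (puncturedCayley S).Adj (g * t⁻¹) g :=
    ⟨(SimpleGraph.mulCayley_adj' _ _ _).2 ⟨h, t, ht, Or.inl (by simp)⟩, hgt, hg⟩
  exact ⟨fun h => hadj.symm.reachable.trans h, fun h => hadj.reachable.trans h⟩

/-- Along a word in the generators, each prefix stays in the component of the previous one, except
that a letter `y` read at the identity starts the component of `y`. -/
theorem exists_mem_component (hsymm : ∀ s ∈ S, s⁻¹ ∈ S)
    (hgen : Subgroup.closure (S : Set G) = ⊤) {g : G} (hg : g ≠ 1) :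
    ∃ s ∈ S, s ≠ 1 ∧ g ∈ component S s := by
  have step : ∀ x : G, ∀ y ∈ S, (x = 1 ∨ ∃ s ∈ S, s ≠ 1 ∧ x ∈ component S s) →
      (x * y = 1 ∨ ∃ s ∈ S, s ≠ 1 ∧ x * y ∈ component S s) := by
    intro x y hy hx
    by_cases hxy : x * y = 1
    · exact Or.inl hxy
    right
    by_cases hx1 : x = 1
    · subst hx1
      rw [one_mul] at hxy ⊢
      exact ⟨y, hy, hxy, mem_component.2 (SimpleGraph.Reachable.refl _)⟩
    obtain ⟨s, hs, hs1, hxs⟩ := hx.resolve_left hx1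
    refine ⟨s, hs, hs1, ?_⟩
    have := mul_inv_mem_component (s := s) (hsymm y hy) hx1 (by simpa using hxy)
    rw [inv_inv] at this
    exact this.2 hxs
  have h : g ∈ Subgroup.closure (S : Set G) := by rw [hgen]; trivial
  have : g = 1 ∨ ∃ s ∈ S, s ≠ 1 ∧ g ∈ component S s := by
    induction h using Subgroup.closure_induction_right with
    | one => exact Or.inl rfl
    | mul_right x _ y hy ih =>
      refine step x y hy ?_
      by_cases hx : x = 1
      · exact Or.inl hx
      · exact ih hx
    | mul_inv_cancel x _ y hy ih =>
      refine step x y⁻¹ (hsymm y hy) ?_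
      by_cases hx : x = 1
      · exact Or.inl hx
      · exact ih hx
  exact this.resolve_left hg

theorem outerBoundary_component_nonempty (hsymm : ∀ s ∈ S, s⁻¹ ∈ S) {s : G} (hs : s ∈ S)
    (hs1 : s ≠ 1) : (outerBoundary S (component S s)).Nonempty :=
  ⟨1, one_notMem_component hs1, s⁻¹, hsymm s hs,
    by simpa using mem_component.2 (SimpleGraph.Reachable.refl _)⟩

/-- Components are separated only by edges at the identity, so for each `t ∈ S` the indicator can
change only at `g = 1` and `g = t`. -/
theorem indicator_component_mem_BDp (hp : 1 ≤ p) {s : G} :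
    (component S s).indicator (1 : G → ℂ) ∈ BDp S p hp := by
  classical
  refine mem_BDp_of_finite hp (D := 1) (fun g => ?_) fun t ht => ?_
  · by_cases hg : g ∈ component S s <;> simp [hg]
  · refine (Set.toFinite {1, t}).subset fun g hg => ?_
    by_contra hn
    simp only [Set.mem_insert_iff, Set.mem_singleton_iff, not_or] at hn
    refine hg ?_
    have := mul_inv_mem_component (s := s) ht hn.1 (fun h => hn.2 (mul_inv_eq_one.1 h))
    simp only [Set.indicator_apply, this, Pi.one_apply]

/-- The indicator function of a component, as an element of `BD_p(G)`. -/
noncomputable def componentIndicator (S : Finset G) (p : ℝ) (hp : 1 ≤ p) (s : G) : BDp S p hp :=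
  ⟨_, indicator_component_mem_BDp (s := s) hp⟩

theorem gelfand_eq_zero_of_finite {hp : 1 ≤ p} {x : Sp S p hp} (hx : x ∈ harmonicBoundary S p hp)
    {f : BDp S p hp} (hf : (Function.support (f : G → ℂ)).Finite) : gelfand f x = 0 := by
  have hp0 : p ≠ 0 := by linarith
  refine hx.2 f ⟨f.2.1, fun ε hε => ⟨f, hf, ?_⟩⟩
  simpa [dpNorm, dpSeminorm, Real.zero_rpow hp0, Real.zero_rpow (inv_ne_zero hp0)] using hε

/-- The product of the functions `1 - 1_C` vanishes off the identity, so `x` kills it and hence one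
of its factors. That component is infinite, since otherwise `x` would kill its indicator too. -/
theorem exists_component_of_mem_harmonicBoundary {hp : 1 ≤ p} (hsymm : ∀ s ∈ S, s⁻¹ ∈ S)
    (hgen : Subgroup.closure (S : Set G) = ⊤) {x : Sp S p hp}
    (hx : x ∈ harmonicBoundary S p hp) :
    ∃ s ∈ S, s ≠ 1 ∧ gelfand (componentIndicator S p hp s) x = 1 ∧ (component S s).Infinite := by
  classical
  set F : BDp S p hp := ∏ s ∈ S.erase 1, (1 - componentIndicator S p hp s) with hF
  have hF0 : gelfand F x = 0 := by
    refine gelfand_eq_zero_of_finite hx ((Set.finite_singleton (1 : G)).subset fun g hg => ?_)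
    by_contra hg1
    obtain ⟨s, hs, hs1, hgs⟩ := exists_mem_component hsymm hgen hg1
    refine hg ?_
    have h1 : (F : G → ℂ) = ∏ s ∈ S.erase 1, (1 - (componentIndicator S p hp s : G → ℂ)) :=
      map_prod (BDp S p hp).val _ _
    rw [h1, Finset.prod_apply]
    refine Finset.prod_eq_zero (Finset.mem_erase.2 ⟨hs1, hs⟩) ?_
    simp [componentIndicator, hgs]
  rw [hF, gelfand_prod, Finset.prod_eq_zero_iff] at hF0
  obtain ⟨s, hs, h⟩ := hF0
  rw [gelfand_sub, gelfand_one, sub_eq_zero] at h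
  refine ⟨s, (Finset.mem_erase.1 hs).2, (Finset.mem_erase.1 hs).1, h.symm, fun hfin => ?_⟩
  have := gelfand_eq_zero_of_finite (f := componentIndicator S p hp s) hx
    (hfin.subset (Set.support_indicator_subset))
  rw [this] at h
  exact one_ne_zero h

theorem gelfand_componentIndicator {hp : 1 ≤ p} (s : G) (τ : Sp S p hp) :
    gelfand (componentIndicator S p hp s) τ = 0 ∨ gelfand (componentIndicator S p hp s) τ = 1 := by
  have h : componentIndicator S p hp s * componentIndicator S p hp s
      = componentIndicator S p hp s := by
    ext g
    change (component S s).indicator (1 : G → ℂ) g * (component S s).indicator (1 : G → ℂ) g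
      = (component S s).indicator (1 : G → ℂ) g
    by_cases hg : g ∈ component S s <;> simp [hg]
  have h1 := congrArg (fun f => gelfand f τ) h
  simp only [gelfand_mul] at h1
  rcases eq_or_ne (gelfand (componentIndicator S p hp s) τ) 0 with h0 | h0
  · exact Or.inl h0
  · exact Or.inr (mul_left_cancel₀ h0 (by rw [h1, mul_one]))

/-! ### Uniform convexity of the `p`-th power -/

/-- The convexity defect of `|x| ^ p` at the midpoint of `a` and `b`. -/
noncomputable def convexityDefect (p a b : ℝ) : ℝ :=
  (|a| ^ p + |b| ^ p) / 2 - |(a + b) / 2| ^ p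

theorem convexityDefect_nonneg {p : ℝ} (hp : 1 < p) (a b : ℝ) : 0 ≤ convexityDefect p a b := by
  have h1 : |(a + b) / 2| ^ p ≤ ((|a| + |b|) / 2) ^ p := by
    refine Real.rpow_le_rpow (abs_nonneg _) ?_ (by linarith)
    rw [abs_div, abs_two]
    linarith [abs_add_le a b]
  have h2 := (strictConvexOn_rpow hp).convexOn.2 (abs_nonneg a) (abs_nonneg b)
    (by norm_num : (0 : ℝ) ≤ 1 / 2) (by norm_num : (0 : ℝ) ≤ 1 / 2) (by norm_num)
  simp only [smul_eq_mul] at h2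
  rw [show 1 / 2 * |a| + 1 / 2 * |b| = (|a| + |b|) / 2 by ring] at h2
  rw [convexityDefect]
  linarith

theorem convexityDefect_pos {p : ℝ} (hp : 1 < p) {a b : ℝ} (hab : a ≠ b) :
    0 < convexityDefect p a b := by
  rw [convexityDefect]
  -- Strict convexity on `[0, ∞)` says nothing when `|a| = |b|`; but then `b = -a` and the midpoint
  -- is `0`.
  by_cases hab' : |a| = |b|
  · have hb : b = -a := by
      rcases abs_eq_abs.1 hab' with h | h
      · exact absurd h hab
      · linarith
    have ha : a ≠ 0 := fun h => hab (by rw [hb, h, neg_zero])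
    have : 0 < |a| ^ p := Real.rpow_pos_of_pos (abs_pos.2 ha) _
    rw [hb, add_neg_cancel, zero_div, abs_zero, abs_neg, Real.zero_rpow (by linarith)]
    linarith
  · have h1 : |(a + b) / 2| ^ p ≤ ((|a| + |b|) / 2) ^ p := by
      refine Real.rpow_le_rpow (abs_nonneg _) ?_ (by linarith)
      rw [abs_div, abs_two]
      linarith [abs_add_le a b]
    have h2 := (strictConvexOn_rpow hp).2 (abs_nonneg a) (abs_nonneg b) hab'
      (by norm_num : (0 : ℝ) < 1 / 2) (by norm_num : (0 : ℝ) < 1 / 2) (by norm_num)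
    simp only [smul_eq_mul] at h2
    rw [show 1 / 2 * |a| + 1 / 2 * |b| = (|a| + |b|) / 2 by ring] at h2
    linarith

theorem continuous_convexityDefect {p : ℝ} (hp : 1 < p) :
    Continuous fun x : ℝ × ℝ => convexityDefect p x.1 x.2 := by
  have hp0 : 0 ≤ p := by linarith
  unfold convexityDefect
  refine Continuous.sub (Continuous.div_const (Continuous.add ?_ ?_) _) ?_
  all_goals exact Continuous.rpow_const (by fun_prop) fun _ => Or.inr hp0

theorem convexityDefect_mul {p c : ℝ} (hc : 0 ≤ c) (a b : ℝ) :
    convexityDefect p (c * a) (c * b) = c ^ p * convexityDefect p a b := by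
  unfold convexityDefect
  rw [← mul_add, mul_div_assoc, abs_mul, abs_mul, abs_mul, abs_of_nonneg hc,
    Real.mul_rpow hc (abs_nonneg _), Real.mul_rpow hc (abs_nonneg _),
    Real.mul_rpow hc (abs_nonneg _)]
  ring

/-- This form of uniform convexity can be summed over edges, for all `p > 1` alike. On unit vectors
with `|a - b| ^ p ≥ δ` the defect has a positive lower bound `m`, and `|a - b| ^ p ≤ 2 ^ p`, whence
`C = 2 ^ p / m`. On the other unit vectors the `δ` term suffices. -/
theorem exists_abs_sub_rpow_le {p : ℝ} (hp : 1 < p) {δ : ℝ} (hδ : 0 < δ) :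
    ∃ C, 0 ≤ C ∧ ∀ a b : ℝ,
      |a - b| ^ p ≤ δ * (|a| ^ p + |b| ^ p) + C * convexityDefect p a b := by
  have hp0 : 0 ≤ p := by linarith
  have hpne : p ≠ 0 := by linarith
  -- By homogeneity it suffices to treat the unit sphere of the sup norm, which is compact.
  set K : Set (ℝ × ℝ) := Metric.sphere 0 1 ∩ {x | δ ≤ |x.1 - x.2| ^ p} with hK
  have hKc : IsCompact K := (isCompact_sphere _ _).inter_right
    (isClosed_le continuous_const (Continuous.rpow_const (by fun_prop) fun _ => Or.inr hp0))
  obtain ⟨m, hm, hmK⟩ : ∃ m : ℝ, 0 < m ∧ ∀ x ∈ K, m ≤ convexityDefect p x.1 x.2 := by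
    rcases K.eq_empty_or_nonempty with h | h
    · exact ⟨1, one_pos, by simp [h]⟩
    · obtain ⟨x, hx, hmin⟩ := hKc.exists_isMinOn h (continuous_convexityDefect hp).continuousOn
      refine ⟨_, convexityDefect_pos hp (a := x.1) (b := x.2) ?_, fun y hy => hmin hy⟩
      intro h12
      have := hx.2
      rw [Set.mem_ofPred_eq, h12, sub_self, abs_zero, Real.zero_rpow hpne] at this
      linarith
  refine ⟨2 ^ p / m, by positivity, fun a b => ?_⟩
  set r : ℝ := ‖((a, b) : ℝ × ℝ)‖ with hr
  rcases eq_or_ne r 0 with h0 | h0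
  · have h0' := norm_eq_zero.1 h0
    simp only [Prod.mk_eq_zero] at h0'
    rw [h0'.1, h0'.2]
    simp [convexityDefect, Real.zero_rpow hpne]
  have hrpos : 0 < r := lt_of_le_of_ne (norm_nonneg _) h0.symm
  have hsphere : ‖((r⁻¹ * a, r⁻¹ * b) : ℝ × ℝ)‖ = 1 := by
    have : ((r⁻¹ * a, r⁻¹ * b) : ℝ × ℝ) = r⁻¹ • (a, b) := rfl
    rw [this, norm_smul, norm_inv, Real.norm_of_nonneg hrpos.le, ← hr, inv_mul_cancel₀ h0]
  have main : ∀ a b : ℝ, ‖((a, b) : ℝ × ℝ)‖ = 1 →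
      |a - b| ^ p ≤ δ * (|a| ^ p + |b| ^ p) + 2 ^ p / m * convexityDefect p a b := by
    intro a b hab
    have hD := convexityDefect_nonneg hp a b
    have hA := Real.rpow_nonneg (abs_nonneg a) p
    have hB := Real.rpow_nonneg (abs_nonneg b) p
    have hab' : max |a| |b| = 1 := by simpa [Prod.norm_def] using hab
    by_cases hd : δ ≤ |a - b| ^ p
    · have h1 : m ≤ convexityDefect p a b := hmK (a, b) ⟨by simpa using hab, hd⟩
      have h2 : |a - b| ^ p ≤ 2 ^ p := by
        refine Real.rpow_le_rpow (abs_nonneg _) ?_ hp0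
        have := abs_sub a b
        linarith [le_max_left |a| |b|, le_max_right |a| |b|]
      have h3 : (2 : ℝ) ^ p ≤ 2 ^ p / m * convexityDefect p a b := by
        rw [div_mul_eq_mul_div, le_div_iff₀ hm]
        exact mul_le_mul_of_nonneg_left h1 (by positivity)
      have : 0 ≤ δ * (|a| ^ p + |b| ^ p) := by positivity
      linarith
    · have h1 : 1 ≤ |a| ^ p + |b| ^ p := by
        rcases max_choice |a| |b| with h | h <;> rw [h] at hab' <;> rw [hab', Real.one_rpow] <;>
          linarith
      have : 0 ≤ 2 ^ p / m * convexityDefect p a b := by positivity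
      nlinarith
  have h := main _ _ hsphere
  have hri : 0 ≤ r⁻¹ := inv_nonneg.2 hrpos.le
  have hrp : 0 < r⁻¹ ^ p := Real.rpow_pos_of_pos (inv_pos.2 hrpos) _
  rw [convexityDefect_mul hri, ← mul_sub, abs_mul, abs_mul, abs_mul, abs_of_nonneg hri,
    Real.mul_rpow hri (abs_nonneg _), Real.mul_rpow hri (abs_nonneg _),
    Real.mul_rpow hri (abs_nonneg _)] at h
  refine le_of_mul_le_mul_left ?_ hrp
  linarith

/-! ### The convexity inequality summed over an index set -/

section Tsum

variable {ι : Type*} {p : ℝ} {a b : ι → ℝ}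

theorem summable_abs_sub_rpow (hp : 1 ≤ p) (ha : Summable fun i => |a i| ^ p)
    (hb : Summable fun i => |b i| ^ p) : Summable fun i => |a i - b i| ^ p := by
  refine Summable.of_nonneg_of_le (fun i => by positivity) (fun i => ?_)
    ((ha.add hb).mul_left (2 ^ p))
  exact (Real.rpow_le_rpow (abs_nonneg _) (abs_sub _ _) (by linarith)).trans
    (add_rpow_le hp (abs_nonneg _) (abs_nonneg _))

theorem summable_abs_midpoint_rpow (hp : 1 < p) (ha : Summable fun i => |a i| ^ p)
    (hb : Summable fun i => |b i| ^ p) : Summable fun i => |(a i + b i) / 2| ^ p := by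
  refine Summable.of_nonneg_of_le (fun i => by positivity) (fun i => ?_)
    ((ha.add hb).div_const 2)
  exact sub_nonneg.1 (convexityDefect_nonneg hp _ _)

theorem tsum_abs_sub_rpow_le (hp : 1 < p) (ha : Summable fun i => |a i| ^ p)
    (hb : Summable fun i => |b i| ^ p) {δ C : ℝ} (h : ∀ x y : ℝ,
      |x - y| ^ p ≤ δ * (|x| ^ p + |y| ^ p) + C * convexityDefect p x y) :
    ∑' i, |a i - b i| ^ p ≤ δ * (∑' i, |a i| ^ p + ∑' i, |b i| ^ p)
      + C * ((∑' i, |a i| ^ p + ∑' i, |b i| ^ p) / 2 - ∑' i, |(a i + b i) / 2| ^ p) := by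
  have h1 := (ha.hasSum.add hb.hasSum)
  have h2 := (h1.mul_left δ).add
    (((h1.div_const 2).sub (summable_abs_midpoint_rpow hp ha hb).hasSum).mul_left C)
  exact hasSum_le (fun i => h (a i) (b i)) (summable_abs_sub_rpow hp.le ha hb).hasSum h2

end Tsum

/-! ### Competitors in the Dirichlet problem -/

section Competitors

variable {X : Type*}

/-- The competitors in the Dirichlet problem on `A`: the functions with values in `[0, M]` that
vanish off `A` and differ from `f` at finitely many points. -/
def competitors (A : Set X) (f : X → ℝ) (M : ℝ) : Set (X → ℝ) :=
  {u | (∀ g, u g ∈ Set.Icc 0 M) ∧ (∀ g, g ∉ A → u g = 0) ∧ (Function.support (u - f)).Finite}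

variable {A : Set X} {f : X → ℝ} {M : ℝ}

theorem midpoint_mem_competitors {u v : X → ℝ} (hu : u ∈ competitors A f M)
    (hv : v ∈ competitors A f M) : (fun g => (u g + v g) / 2) ∈ competitors A f M := by
  refine ⟨fun g => ?_, fun g hg => by simp [hu.2.1 g hg, hv.2.1 g hg],
    (hu.2.2.union hv.2.2).subset fun g hg => ?_⟩
  · obtain ⟨h1, h2⟩ := hu.1 g
    obtain ⟨h3, h4⟩ := hv.1 g
    constructor <;> linarith
  · by_contra hn
    simp only [Set.mem_union, Function.mem_support, not_or, not_not, Pi.sub_apply] at hn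
    refine hg ?_
    simp only [Pi.sub_apply]
    linarith

theorem update_mem_competitors [DecidableEq X] {u : X → ℝ} (hu : u ∈ competitors A f M) {a : X}
    (ha : a ∈ A) {c : ℝ} (hc : c ∈ Set.Icc 0 M) : Function.update u a c ∈ competitors A f M := by
  refine ⟨fun g => ?_, fun g hg => ?_, (hu.2.2.union (Set.finite_singleton a)).subset
    fun g hg => ?_⟩
  · rcases eq_or_ne g a with rfl | h
    · simpa using hc
    · simpa [h] using hu.1 g
  · rw [Function.update_of_ne (ne_of_mem_of_not_mem ha hg).symm]
    exact hu.2.1 g hg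
  · by_contra hn
    simp only [Set.mem_union, Set.mem_singleton_iff, not_or] at hn
    refine hn.1 ?_
    simpa [hn.2] using hg

end Competitors

/-! ### Gradients and energy -/

/-- The gradient of `u`, indexed by the directed edges of the Cayley graph. -/
def grad (S : Finset G) (u : G → ℝ) (i : S × G) : ℝ := u (i.2 * (i.1 : G)⁻¹) - u i.2

/-- The `p`-energy of `u`. -/
noncomputable def energy (S : Finset G) (p : ℝ) (u : G → ℝ) : ℝ := ∑' i, |grad S u i| ^ p

theorem grad_sub (u v : G → ℝ) (i : S × G) : grad S (u - v) i = grad S u i - grad S v i := by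
  simp only [grad, Pi.sub_apply]; ring

theorem grad_midpoint (u v : G → ℝ) (i : S × G) :
    grad S (fun g => (u g + v g) / 2) i = (grad S u i + grad S v i) / 2 := by
  simp only [grad]; ring

theorem finite_edges {F : Set G} (hF : F.Finite) :
    {i : S × G | i.2 ∈ F ∨ i.2 * (i.1 : G)⁻¹ ∈ F}.Finite := by
  have h := Set.Finite.prod (Set.finite_univ (α := S)) hF
  refine (h.union (h.image fun i => (i.1, i.2 * (i.1 : G)))).subset ?_
  rintro ⟨s, g⟩ (hi | hi)
  · exact Or.inl ⟨trivial, hi⟩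
  · exact Or.inr ⟨(s, g * (s : G)⁻¹), ⟨trivial, hi⟩, by simp⟩

theorem summable_grad_of_finite (hf : Summable fun i => |grad S f i| ^ p) {u : G → ℝ}
    (hu : (Function.support (u - f)).Finite) : Summable fun i => |grad S u i| ^ p := by
  refine hf.congr_cofinite ((finite_edges hu).subset fun i hi => ?_)
  by_contra hn
  simp only [Set.mem_ofPred_eq, Function.mem_support, not_or, not_not, Pi.sub_apply,
    sub_eq_zero] at hn
  refine hi ?_
  change |grad S f i| ^ p = |grad S u i| ^ p
  simp only [grad, hn.1, hn.2]

/-! ### The Dirichlet problem -/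

section Dirichlet

variable {A : Set G} {f : G → ℝ} {M : ℝ}

/-- The midpoint of two competitors is a competitor and has energy at least `m`, so the total
convexity defect of two late terms is small. -/
theorem energy_sub_le_of_minimizing (hp : 1 < p) (hf : Summable fun i => |grad S f i| ^ p)
    {m : ℝ} (hm : ∀ u ∈ competitors A f M, m ≤ energy S p u) {U : ℕ → G → ℝ}
    (hU : ∀ n, U n ∈ competitors A f M) (hUm : ∀ n, energy S p (U n) ≤ m + 1 / (n + 1))
    {ε : ℝ} (hε : 0 < ε) :
    ∃ N, ∀ n ≥ N, ∀ k ≥ N, energy S p (U n - U k) ≤ ε := by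
  have hm0 : 0 ≤ m + 1 := by
    have h1 := hUm 0
    have h2 : 0 ≤ energy S p (U 0) := tsum_nonneg fun i => by positivity
    simp at h1
    linarith
  -- Two late energies sum to at most `2 (m + 1)`, so the `δ` term costs at most `ε / 2`; `N` is
  -- then chosen so that the defect term costs at most `ε / 2`. The extra `+ 1` keeps each
  -- denominator positive.
  obtain ⟨C, hC, hle⟩ := exists_abs_sub_rpow_le hp (δ := ε / 2 / (2 * (m + 1) + 1))
    (by positivity)
  obtain ⟨N, hN⟩ := exists_nat_one_div_lt (K := ℝ) (ε := ε / 2 / (C + 1)) (by positivity)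
  refine ⟨N, fun n hn k hk => ?_⟩
  have hsn := summable_grad_of_finite hf (hU n).2.2
  have hsk := summable_grad_of_finite hf (hU k).2.2
  have h1 := tsum_abs_sub_rpow_le hp hsn hsk hle
  have h2 := hm _ (midpoint_mem_competitors (hU n) (hU k))
  have h3 : ∀ j ≥ N, energy S p (U j) ≤ m + 1 / (N + 1) := fun j hj =>
    (hUm j).trans (by gcongr)
  have h4 : (1 : ℝ) / (N + 1) ≤ 1 := by
    rw [div_le_one (by positivity)]
    have : (0 : ℝ) ≤ N := Nat.cast_nonneg N
    linarith
  have h5 := h3 n hn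
  have h6 := h3 k hk
  unfold energy at *
  simp only [grad_sub, grad_midpoint] at h2 ⊢
  set x := ∑' i, |grad S (U n) i| ^ p
  set y := ∑' i, |grad S (U k) i| ^ p
  set z := ∑' i, |(grad S (U n) i + grad S (U k) i) / 2| ^ p
  refine h1.trans ?_
  have h7 : ε / 2 / (2 * (m + 1) + 1) * (x + y) ≤ ε / 2 := by
    rw [div_mul_eq_mul_div, div_le_iff₀ (by positivity)]
    exact mul_le_mul_of_nonneg_left (by linarith) (by positivity)
  have h8 : C * ((x + y) / 2 - z) ≤ ε / 2 := by
    have h9 : (x + y) / 2 - z ≤ ε / 2 / (C + 1) := by linarith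
    refine (mul_le_mul_of_nonneg_left h9 hC).trans ?_
    rw [mul_div_assoc', div_le_iff₀ (by positivity)]
    nlinarith
  linarith

/-- Fatou's lemma for counting measure: bounds on finite partial sums pass to the limit. -/
theorem energy_le_of_tendsto (hp : 0 ≤ p) {l : Filter ℕ} [l.NeBot] {V : ℕ → G → ℝ} {v : G → ℝ}
    (hV : ∀ g, Tendsto (fun n => V n g) l (𝓝 (v g))) {ε : ℝ}
    (h : ∀ᶠ n in l, (Summable fun i => |grad S (V n) i| ^ p) ∧ energy S p (V n) ≤ ε) :
    (Summable fun i => |grad S v i| ^ p) ∧ energy S p v ≤ ε := by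
  have key : ∀ T : Finset (S × G), ∑ i ∈ T, |grad S v i| ^ p ≤ ε := fun T => by
    have ht : Tendsto (fun n => ∑ i ∈ T, |grad S (V n) i| ^ p) l
        (𝓝 (∑ i ∈ T, |grad S v i| ^ p)) :=
      tendsto_finsetSum _ fun i _ =>
        (((hV _).sub (hV _)).abs).rpow_const (Or.inr hp)
    exact le_of_tendsto ht (h.mono fun n hn =>
      (hn.1.sum_le_tsum T fun i _ => by positivity).trans hn.2)
  exact ⟨summable_of_sum_le (fun i => by positivity) key,
    Real.tsum_le_of_sum_le (fun i => by positivity) key⟩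

/-- Near-minimality of a competitor, tested at a single point and localized to the edges there. -/
theorem sum_grad_le_of_near_minimizer [DecidableEq G] (hp : 0 ≤ p)
    (hf : Summable fun i => |grad S f i| ^ p) {m η : ℝ}
    (hm : ∀ u ∈ competitors A f M, m ≤ energy S p u) {u : G → ℝ} (hu : u ∈ competitors A f M)
    (hum : energy S p u ≤ m + η) {a : G} (ha : a ∈ A) {T : Finset (S × G)}
    (hT : ∀ i : S × G, i.2 = a ∨ i.2 * (i.1 : G)⁻¹ = a → i ∈ T) (t : ℝ) :
    ∑ i ∈ T, |grad S u i| ^ p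
      ≤ ∑ i ∈ T, |grad S u i + t * grad S (Pi.single a 1) i| ^ p + η := by
  have hM : 0 ≤ M := (hu.1 a).1.trans (hu.1 a).2
  -- Moving `u a` by an arbitrary `t` may leave `[0, M]`. Clipping restores the constraint, fixes
  -- the other values and, being 1-Lipschitz, increases no gradient.
  set c : ℝ → ℝ := fun x => max (min x M) 0 with hc
  have hcu : ∀ g, c (u g) = u g := fun g => by
    simp only [hc]
    rw [min_eq_left (hu.1 g).2, max_eq_left (hu.1 g).1]
  have hclip : ∀ x y, |c x - c y| ≤ |x - y| := fun x y =>
    (abs_max_sub_max_le_abs _ _ _).trans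
      ((abs_min_sub_min_le_max _ _ _ _).trans (by simp))
  set v := Function.update u a (c (u a + t)) with hv
  have hvK : v ∈ competitors A f M := update_mem_competitors hu ha
    ⟨le_max_right _ _, max_le (min_le_right _ _) hM⟩
  have hvc : ∀ g, v g = c (u g + t * (Pi.single a 1 : G → ℝ) g) := fun g => by
    rcases eq_or_ne g a with rfl | h
    · simp [hv]
    · simp [hv, h, hcu]
  have h1 : energy S p u ≤ energy S p v + η := hum.trans (by linarith [hm v hvK])
  have hsu := summable_grad_of_finite hf hu.2.2
  have hsv := summable_grad_of_finite hf hvK.2.2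
  have hout : ∑' i : ↥((T : Set (S × G))ᶜ), |grad S u i| ^ p
      = ∑' i : ↥((T : Set (S × G))ᶜ), |grad S v i| ^ p := by
    refine tsum_congr fun i => ?_
    have hi : ¬ ((i : S × G).2 = a ∨ (i : S × G).2 * ((i : S × G).1 : G)⁻¹ = a) :=
      fun h => i.2 (hT _ h)
    rw [not_or] at hi
    simp only [grad, hv, Function.update_of_ne hi.1, Function.update_of_ne hi.2]
  unfold energy at h1
  rw [← hsu.sum_add_tsum_compl (s := T), ← hsv.sum_add_tsum_compl (s := T), hout] at h1
  have h2 : ∑ i ∈ T, |grad S v i| ^ p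
      ≤ ∑ i ∈ T, |grad S u i + t * grad S (Pi.single a 1) i| ^ p := by
    refine Finset.sum_le_sum fun i _ => Real.rpow_le_rpow (abs_nonneg _) ?_ hp
    simp only [grad, hvc]
    refine (hclip _ _).trans (le_of_eq ?_)
    congr 1; ring
  linarith

/-- The Euler-Lagrange equation of a function that locally minimizes the energy under variations
at `a`. -/
theorem pLaplacian_eq_zero_of_minimizer [DecidableEq G] (hp : 1 < p) (hsymm : ∀ s ∈ S, s⁻¹ ∈ S)
    {u : G → ℝ} {a : G} {B : Finset G} (ha : a ∈ B) (hB : ∀ s ∈ S, a * s ∈ B)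
    (hmin : ∀ t : ℝ, ∑ i ∈ Finset.univ ×ˢ B, |grad S u i| ^ p
      ≤ ∑ i ∈ Finset.univ ×ˢ B, |grad S u i + t * grad S (Pi.single a 1) i| ^ p) :
    ∑ s ∈ S, |u (a * s⁻¹) - u a| ^ (p - 2) * (u (a * s⁻¹) - u a) = 0 := by
  set ψ : ℝ → ℝ := fun x => |x| ^ (p - 2) * x with hψ
  have hψneg : ∀ x, ψ (-x) = -ψ x := fun x => by simp [hψ]
  have hder : HasDerivAt
      (fun t : ℝ => ∑ i ∈ Finset.univ ×ˢ B, |grad S u i + t * grad S (Pi.single a 1) i| ^ p)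
      (∑ i ∈ Finset.univ ×ˢ B, p * ψ (grad S u i) * grad S (Pi.single a 1) i) 0 := by
    refine HasDerivAt.fun_sum fun i _ => ?_
    have h1 : HasDerivAt (fun t : ℝ => grad S u i + t * grad S (Pi.single a 1) i)
        (grad S (Pi.single a 1) i) 0 := by
      simpa using ((hasDerivAt_id (0 : ℝ)).mul_const (grad S (Pi.single a 1) i)).const_add
        (grad S u i)
    have h2 := hasDerivAt_abs_rpow (grad S u i + 0 * grad S (Pi.single a 1) i) hp
    have h3 := h2.comp (0 : ℝ) h1
    rw [zero_mul, add_zero, mul_assoc p] at h3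
    exact h3
  have hzero := IsLocalMin.hasDerivAt_eq_zero
    (Eventually.of_forall fun t => by simpa using hmin t) hder
  simp only [mul_assoc] at hzero
  rw [← Finset.mul_sum, Finset.sum_product] at hzero
  have h1 := (mul_eq_zero.1 hzero).resolve_left (by linarith)
  -- For each `s`, the variation at `a` is felt only on the edges indexed by `(s, a)` and `(s, a *
  -- s)`.
  have h2 : ∀ s : S, ∑ g ∈ B, ψ (grad S u (s, g)) * grad S (Pi.single a 1) (s, g)
      = ψ (u a - u (a * s)) - ψ (u (a * (s : G)⁻¹) - u a) := fun s => by
    have e1 : ∑ g ∈ B, ψ (grad S u (s, g)) * (Pi.single a 1 : G → ℝ) (g * (s : G)⁻¹)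
        = ψ (u a - u (a * s)) := by
      rw [Finset.sum_eq_single_of_mem (a * (s : G)) (hB s s.2)]
      · simp [grad]
      · intro g _ hg
        have : g * (s : G)⁻¹ ≠ a := fun h => hg (by rw [← h, inv_mul_cancel_right])
        simp [this]
    have e2 : ∑ g ∈ B, ψ (grad S u (s, g)) * (Pi.single a 1 : G → ℝ) g
        = ψ (u (a * (s : G)⁻¹) - u a) := by
      rw [Finset.sum_eq_single_of_mem a ha]
      · simp [grad]
      · intro g _ hg
        simp [hg]
    rw [← e1, ← e2, ← Finset.sum_sub_distrib]
    exact Finset.sum_congr rfl fun g _ => mul_sub _ _ _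
  rw [Finset.sum_congr rfl fun s _ => h2 s, Finset.sum_sub_distrib,
    Finset.sum_coe_sort S (fun s => ψ (u a - u (a * s))),
    Finset.sum_coe_sort S (fun s => ψ (u (a * s⁻¹) - u a))] at h1
  -- Since `S` is symmetric and `ψ` is odd, both families of edges contribute equally: the
  -- derivative is `-2p` times the desired sum.
  have h3 : ∑ s ∈ S, ψ (u a - u (a * s)) = -∑ s ∈ S, ψ (u (a * s⁻¹) - u a) := by
    rw [← Finset.sum_neg_distrib]
    refine Finset.sum_bij' (fun s _ => s⁻¹) (fun s _ => s⁻¹) (fun s hs => hsymm s hs)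
      (fun s hs => hsymm s hs) (fun s _ => inv_inv s) (fun s _ => inv_inv s) fun s _ => ?_
    rw [inv_inv, ← hψneg, neg_sub]
  rw [h3] at h1
  change ∑ s ∈ S, ψ (u (a * s⁻¹) - u a) = 0
  linarith

/-- Solution of the Dirichlet problem on `A` with boundary values `f`. -/
theorem exists_dirichlet_solution (hp : 1 < p) (hsymm : ∀ s ∈ S, s⁻¹ ∈ S)
    (hf : Summable fun i => |grad S f i| ^ p) (hfM : ∀ g, f g ∈ Set.Icc 0 M)
    (hfA : ∀ g, g ∉ A → f g = 0) :
    ∃ u : G → ℝ, (∀ g, u g ∈ Set.Icc 0 M) ∧ (∀ g, g ∉ A → u g = 0) ∧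
      (Summable fun i => |grad S u i| ^ p) ∧
      (∀ a ∈ A, ∑ s ∈ S, |u (a * s⁻¹) - u a| ^ (p - 2) * (u (a * s⁻¹) - u a) = 0) ∧
      ∀ ε > 0, ∃ v ∈ competitors A f M, (Summable fun i => |grad S (u - v) i| ^ p) ∧
        energy S p (u - v) ≤ ε := by
  classical
  have hp0 : 0 ≤ p := by linarith
  have hfK : f ∈ competitors A f M := ⟨hfM, hfA, by simp⟩
  set m := sInf (energy S p '' competitors A f M)
  have hbdd : BddBelow (energy S p '' competitors A f M) :=
    ⟨0, by rintro _ ⟨u, -, rfl⟩; exact tsum_nonneg fun i => by positivity⟩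
  have hm : ∀ u ∈ competitors A f M, m ≤ energy S p u := fun u hu => csInf_le hbdd ⟨u, hu, rfl⟩
  have hex : ∀ n : ℕ, ∃ u ∈ competitors A f M, energy S p u ≤ m + 1 / (n + 1) := fun n => by
    obtain ⟨_, ⟨u, hu, rfl⟩, hlt⟩ := exists_lt_of_csInf_lt (Set.Nonempty.image _ ⟨f, hfK⟩)
      (lt_add_of_pos_right m (by positivity : (0 : ℝ) < 1 / (n + 1)))
    exact ⟨u, hu, hlt.le⟩
  choose U hU hUm using hex
  -- A nonprincipal ultrafilter gives pointwise limits at all `g` simultaneously, in place of a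
  -- diagonal subsequence.
  have hlim : ∀ g, ∃ x ∈ Set.Icc 0 M, Tendsto (fun n => U n g) (hyperfilter ℕ : Filter ℕ) (𝓝 x) :=
    fun g => isCompact_Icc.ultrafilter_le_nhds ((hyperfilter ℕ).map fun n => U n g)
      (le_principal_iff.2 (univ_mem' (f := (hyperfilter ℕ : Filter ℕ)) fun n => (hU n).1 g))
  choose u huM hu using hlim
  have hsU : ∀ n, Summable fun i => |grad S (U n) i| ^ p := fun n =>
    summable_grad_of_finite hf (hU n).2.2
  have hat : (hyperfilter ℕ : Filter ℕ) ≤ atTop := Nat.hyperfilter_le_atTop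
  have happrox : ∀ ε > 0, ∃ N, (Summable fun i => |grad S (u - U N) i| ^ p) ∧
      energy S p (u - U N) ≤ ε := fun ε hε => by
    obtain ⟨N, hN⟩ := energy_sub_le_of_minimizing hp hf hm hU hUm hε
    refine ⟨N, energy_le_of_tendsto hp0 (V := fun n => U n - U N)
      (fun g => (hu g).sub_const _) ?_⟩
    filter_upwards [hat (eventually_ge_atTop N)] with n hn
    refine ⟨?_, hN n hn N le_rfl⟩
    simp only [grad_sub]
    exact summable_abs_sub_rpow hp.le (hsU n) (hsU N)
  refine ⟨u, huM, fun g hg => ?_, ?_, fun a ha => ?_, fun ε hε => ?_⟩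
  · refine tendsto_nhds_unique (hu g) ?_
    simp only [(hU _).2.1 g hg]
    exact tendsto_const_nhds
  · refine (energy_le_of_tendsto (ε := m + 1) hp0 hu (Eventually.of_forall fun n =>
      ⟨hsU n, (hUm n).trans ?_⟩)).1
    have : (1 : ℝ) / (n + 1) ≤ 1 := by
      rw [div_le_one (by positivity)]
      have : (0 : ℝ) ≤ n := Nat.cast_nonneg n
      linarith
    linarith
  -- The limit `u` may differ from `f` at infinitely many points and so need not be a competitor.
  -- The near-minimality of `U n` on the finitely many edges in `T` is passed to the limit instead.
  · refine pLaplacian_eq_zero_of_minimizer hp hsymm (B := insert a (S.image (a * ·)))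
      (Finset.mem_insert_self _ _)
      (fun s hs => Finset.mem_insert_of_mem (Finset.mem_image_of_mem _ hs)) fun t => ?_
    set T : Finset (S × G) := Finset.univ ×ˢ insert a (S.image (a * ·)) with hT
    have hTa : ∀ i : S × G, i.2 = a ∨ i.2 * (i.1 : G)⁻¹ = a → i ∈ T := by
      rintro ⟨s, g⟩ h
      refine Finset.mem_product.2 ⟨Finset.mem_univ _, ?_⟩
      rcases h with h | h
      · exact Finset.mem_insert.2 (Or.inl h)
      · exact Finset.mem_insert_of_mem
          (Finset.mem_image.2 ⟨s, s.2, by simp only at h; rw [← h, inv_mul_cancel_right]⟩)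
    have hgrad : ∀ i, Tendsto (fun n => grad S (U n) i) (hyperfilter ℕ : Filter ℕ)
        (𝓝 (grad S u i)) := fun i => (hu _).sub (hu _)
    have h0 : Tendsto (fun n : ℕ => (1 : ℝ) / (n + 1)) (hyperfilter ℕ : Filter ℕ) (𝓝 0) :=
      tendsto_one_div_add_atTop_nhds_zero_nat.mono_left hat
    have h1 : Tendsto (fun n => ∑ i ∈ T, |grad S (U n) i| ^ p) (hyperfilter ℕ : Filter ℕ)
        (𝓝 (∑ i ∈ T, |grad S u i| ^ p)) :=
      tendsto_finsetSum _ fun i _ => (hgrad i).abs.rpow_const (Or.inr hp0)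
    have h2 : Tendsto (fun n : ℕ => ∑ i ∈ T, |grad S (U n) i + t * grad S (Pi.single a 1) i| ^ p
          + 1 / (n + 1)) (hyperfilter ℕ : Filter ℕ)
        (𝓝 (∑ i ∈ T, |grad S u i + t * grad S (Pi.single a 1) i| ^ p + 0)) :=
      (tendsto_finsetSum _ fun i _ =>
        ((hgrad i).add_const _).abs.rpow_const (Or.inr hp0)).add h0
    rw [add_zero] at h2
    exact le_of_tendsto_of_tendsto' h1 h2 fun n =>
      sum_grad_le_of_near_minimizer hp0 hf hm (hU n) (hUm n) ha hTa t
  · obtain ⟨N, hN⟩ := happrox ε hε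
    exact ⟨U N, hU N, hN⟩

end Dirichlet

/-! ### Real functions in `D_p(G)` -/

theorem norm_ofReal_sub_rpow (v : G → ℝ) (s : S) (g : G) :
    ‖((v (g * (s : G)⁻¹) : ℂ)) - (v g : ℂ)‖ ^ p = |grad S v (s, g)| ^ p := by
  rw [← Complex.ofReal_sub, Complex.norm_real, Real.norm_eq_abs, grad]

theorem ofReal_mem_Dp_iff {v : G → ℝ} :
    (fun g => (v g : ℂ)) ∈ Dp S p ↔ Summable fun i => |grad S v i| ^ p := by
  constructor
  · intro h
    refine (summable_prod_of_nonneg fun i => by positivity).2 ⟨fun s => ?_, Summable.of_finite⟩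
    simpa only [norm_ofReal_sub_rpow v s] using h s s.2
  · intro h s hs
    have := ((summable_prod_of_nonneg fun i => by positivity).1 h).1 ⟨s, hs⟩
    simpa only [← norm_ofReal_sub_rpow v ⟨s, hs⟩] using this

theorem dpSeminorm_ofReal {v : G → ℝ} (h : Summable fun i => |grad S v i| ^ p) :
    dpSeminorm S p (fun g => (v g : ℂ)) = energy S p v ^ (1 / p) := by
  rw [dpSeminorm, energy, h.tsum_prod, tsum_fintype, ← Finset.sum_coe_sort S]
  simp only [norm_ofReal_sub_rpow v]

theorem dpNorm_ofReal (hp : 0 < p) {v : G → ℝ} (h : Summable fun i => |grad S v i| ^ p)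
    (hv : v 1 = 0) : dpNorm S p (fun g => (v g : ℂ)) = energy S p v ^ (1 / p) := by
  have h0 : 0 ≤ energy S p v := tsum_nonneg fun i => by positivity
  rw [dpNorm, dpSeminorm_ofReal h, hv, ← Real.rpow_mul h0, one_div_mul_cancel hp.ne',
    Real.rpow_one]
  simp [Real.zero_rpow hp.ne']

theorem pLaplacian_ofReal (v : G → ℝ) (a : G) :
    pLaplacian S p (fun g => (v g : ℂ)) a
      = ((∑ s ∈ S, |v (a * s⁻¹) - v a| ^ (p - 2) * (v (a * s⁻¹) - v a) : ℝ) : ℂ) := by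
  rw [pLaplacian, Complex.ofReal_sum]
  refine Finset.sum_congr rfl fun s _ => ?_
  rw [← Complex.ofReal_sub, Complex.norm_real, Real.norm_eq_abs, ← Complex.ofReal_mul]

/-! ### Inner potentials with prescribed values on the harmonic boundary -/

/-- A nonnegative function in `BD_p(G)` supported in `A ∌ e` agrees on `∂_p(G)` with a nonnegative
function that is `p`-harmonic on `A` and vanishes off `A`. -/
theorem exists_pHarmonic_extension (hp : 1 < p) (hsymm : ∀ s ∈ S, s⁻¹ ∈ S) {A : Set G}
    (hA : (1 : G) ∉ A) {f : BDp S p hp.le} (hf : ∀ g, 0 ≤ (f : G → ℂ) g)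
    (hfA : ∀ g, g ∉ A → (f : G → ℂ) g = 0) :
    ∃ (u : G → ℝ) (v : BDp S p hp.le), (∀ g, (v : G → ℂ) g = u g) ∧ (∀ g, 0 ≤ u g) ∧
      (∀ g, g ∉ A → u g = 0) ∧
      (∀ a ∈ A, ∑ s ∈ S, |u (a * s⁻¹) - u a| ^ (p - 2) * (u (a * s⁻¹) - u a) = 0) ∧
      ∀ x ∈ harmonicBoundary S p hp.le, gelfand v x = gelfand f x := by
  have hp0 : 0 < p := by linarith
  obtain ⟨M, hM⟩ := f.2.2
  set r : G → ℝ := fun g => ((f : G → ℂ) g).re with hr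
  have hfr : (f : G → ℂ) = fun g => (r g : ℂ) := by
    ext g
    exact Complex.eq_re_of_ofReal_le (r := 0) (by simpa using hf g)
  have hrs : Summable fun i => |grad S r i| ^ p := by
    rw [← ofReal_mem_Dp_iff, ← hfr]
    exact f.2.1
  obtain ⟨u, huM, huA, hus, hharm, happ⟩ := exists_dirichlet_solution (A := A) (M := M) hp hsymm hrs
    (fun g => ⟨(Complex.le_def.1 (hf g)).1, (Complex.re_le_norm _).trans (hM g)⟩)
    (fun g hg => by simp [hr, hfA g hg])
  have huB : (fun g => (u g : ℂ)) ∈ BDp S p hp.le :=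
    ⟨ofReal_mem_Dp_iff.2 hus, M, fun g => by
      rw [Complex.norm_real, Real.norm_of_nonneg (huM g).1]
      exact (huM g).2⟩
  refine ⟨u, ⟨_, huB⟩, fun g => rfl, fun g => (huM g).1, huA, hharm, fun x hx => ?_⟩
  rw [← sub_eq_zero, ← gelfand_sub]
  refine hx.2 _ ⟨Subtype.property (_ : BDp S p hp.le) |>.1, fun ε hε => ?_⟩
  obtain ⟨v, hv, hvs, hvε⟩ := happ ((ε / 2) ^ p) (by positivity)
  -- For a competitor `v` near `u`, the function `v - r` has finite support and `(u - f) - (v - r) =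
  -- u - v` has small energy. Since `1 ∉ A`, the term at the identity in the norm vanishes.
  refine ⟨fun g => ((v g - r g : ℝ) : ℂ), hv.2.2.subset fun g hg => ?_, ?_⟩
  · refine fun h0 => hg ?_
    change ((v g - r g : ℝ) : ℂ) = 0
    rw [show v g - r g = 0 from h0, Complex.ofReal_zero]
  · have h1 : ((⟨_, huB⟩ - f : BDp S p hp.le) : G → ℂ) - (fun g => ((v g - r g : ℝ) : ℂ))
        = fun g => (((u - v) g : ℝ) : ℂ) := by
      ext g
      change (u g : ℂ) - (f : G → ℂ) g - ((v g - r g : ℝ) : ℂ) = ((u g - v g : ℝ) : ℂ)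
      rw [hfr]
      push_cast
      ring
    rw [h1, dpNorm_ofReal hp0 hvs (by simp [huA 1 hA, hv.2.1 1 hA])]
    have h0 : 0 ≤ energy S p (u - v) := tsum_nonneg fun i => by positivity
    calc energy S p (u - v) ^ (1 / p) ≤ ((ε / 2) ^ p) ^ (1 / p) :=
          Real.rpow_le_rpow h0 hvε (by positivity)
      _ = ε / 2 := by
          rw [← Real.rpow_mul (by positivity), mul_one_div_cancel hp0.ne', Real.rpow_one]
      _ < ε := by linarith

/-- Normalizing a nonzero solution of the Dirichlet problem gives an inner potential. -/
theorem exists_isInnerPotential_smul {hp : 1 ≤ p} {A : Set G} {u : G → ℝ} {v : BDp S p hp}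
    (hv : ∀ g, (v : G → ℂ) g = u g) (hu : ∀ g, 0 ≤ u g) (huA : ∀ g, g ∉ A → u g = 0)
    (hharm : ∀ a ∈ A, ∑ s ∈ S, |u (a * s⁻¹) - u a| ^ (p - 2) * (u (a * s⁻¹) - u a) = 0)
    (hne : v ≠ 0) :
    ∃ c : ℝ, 0 < c ∧ IsInnerPotential A ((c : ℂ) • v) := by
  obtain ⟨M, hM⟩ := v.2.2
  have hbdd : BddAbove (u '' A) := ⟨M, by
    rintro _ ⟨g, -, rfl⟩
    have := hM g
    rwa [hv, Complex.norm_real, Real.norm_of_nonneg (hu g)] at this⟩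
  obtain ⟨a, ha⟩ : ∃ a, u a ≠ 0 := by
    by_contra! h
    refine hne (Subtype.ext (funext fun g => ?_))
    rw [hv, h]
    simp
  have haA : a ∈ A := by
    by_contra h
    exact ha (huA a h)
  set c := sSup (u '' A)
  have hle : ∀ g ∈ A, u g ≤ c := fun g hg => le_csSup hbdd ⟨g, hg, rfl⟩
  have hc : 0 < c := (lt_of_le_of_ne (hu a) ha.symm).trans_le (hle a haA)
  have hw : ((((c⁻¹ : ℝ) : ℂ) • v : BDp S p hp) : G → ℂ) = fun g => ((c⁻¹ * u g : ℝ) : ℂ) := by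
    ext g
    change ((c⁻¹ : ℝ) : ℂ) * (v : G → ℂ) g = _
    rw [hv, Complex.ofReal_mul]
  refine ⟨c⁻¹, inv_pos.2 hc, fun g => ?_, fun a ha => ?_, fun g hg => ?_, ?_, fun b hb => ?_⟩
  · rw [hw]
    exact Complex.zero_le_real.2 (mul_nonneg (inv_nonneg.2 hc.le) (hu g))
  · rw [hw, pLaplacian_ofReal, Complex.ofReal_eq_zero]
    -- The `p`-Laplacian is homogeneous of degree `p - 1`.
    have h1 := congrArg (fun y => |c⁻¹| ^ (p - 2) * c⁻¹ * y) (hharm a ha)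
    simp only [Finset.mul_sum, mul_zero] at h1
    rw [← h1]
    refine Finset.sum_congr rfl fun s _ => ?_
    rw [← mul_sub, abs_mul, Real.mul_rpow (abs_nonneg _) (abs_nonneg _)]
    ring
  · rw [hw]
    simp [huA g hg.1]
  · rintro _ ⟨g, hg, rfl⟩
    simp only [hw, Complex.ofReal_re]
    rw [inv_mul_le_iff₀ hc, mul_one]
    exact hle g hg
  · have h1 : c ≤ c * b := by
      refine csSup_le ⟨_, a, haA, rfl⟩ ?_
      rintro _ ⟨g, hg, rfl⟩
      have := hb ⟨g, hg, rfl⟩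
      simp only [hw, Complex.ofReal_re] at this
      rwa [inv_mul_le_iff₀ hc] at this
    exact le_of_mul_le_mul_left (by linarith) hc

/-! ### Small massive neighbourhoods of a boundary point -/

theorem exists_massive_subset (hp : 1 < p) (hsymm : ∀ s ∈ S, s⁻¹ ∈ S)
    (hgen : Subgroup.closure (S : Set G) = ⊤) {x : Sp S p hp.le}
    (hx : x ∈ harmonicBoundary S p hp.le) {U : Set (Sp S p hp.le)} (hU : U ∈ 𝓝 x) :
    ∃ (A : Set G) (u : BDp S p hp.le), IsMassive S p hp.le A ∧ IsInnerPotential A u ∧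
      (∀ g, g ∉ A → (u : G → ℂ) g = 0) ∧ x ∈ positiveSet u ∧
      positiveSet u ∩ harmonicBoundary S p hp.le ⊆ U := by
  obtain ⟨b, hb, hbx, hbU⟩ := exists_bump hU
  obtain ⟨s, hs, hs1, hsx, hinf⟩ := exists_component_of_mem_harmonicBoundary hsymm hgen hx
  set f := b * componentIndicator S p hp.le s with hf
  have hfg : ∀ g, (f : G → ℂ) g = (b : G → ℂ) g * (component S s).indicator (1 : G → ℂ) g :=
    fun g => rfl
  obtain ⟨r, v, hvr, hr, hrA, hharm, hvf⟩ := exists_pHarmonic_extension hp hsymm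
    (one_notMem_component hs1) (f := f)
    (fun g => by
      rw [hfg]
      exact mul_nonneg (hb g) (Set.indicator_nonneg (fun _ _ => zero_le_one) _))
    (fun g hg => by rw [hfg, Set.indicator_of_notMem hg, mul_zero])
  have hvx : 0 < gelfand v x := by
    rw [hvf x hx, hf, gelfand_mul, hsx, mul_one]
    exact hbx
  obtain ⟨c, hc, hpot⟩ := exists_isInnerPotential_smul hvr hr hrA hharm
    (fun h => hvx.ne' (by rw [h, gelfand_zero]))
  have hc' : (0 : ℂ) < c := Complex.zero_lt_real.2 hc
  refine ⟨component S s, (c : ℂ) • v, ⟨hinf, induce_component_connected s,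
    outerBoundary_component_nonempty hsymm hs hs1, _, hpot⟩, hpot, fun g hg => ?_, ?_, ?_⟩
  · change (c : ℂ) * (v : G → ℂ) g = 0
    rw [hvr, hrA g hg, Complex.ofReal_zero, mul_zero]
  · change 0 < gelfand _ x
    rw [gelfand_smul]
    exact mul_pos hc' hvx
  · rintro τ ⟨hτ, hτb⟩
    change 0 < gelfand _ τ at hτ
    rw [gelfand_smul, hvf τ hτb, hf, gelfand_mul] at hτ
    apply hbU
    -- The indicator is idempotent, so its transform is `0` or `1`; the value `0` would make the
    -- product vanish.
    rcases gelfand_componentIndicator (hp := hp.le) s τ with h | h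
    · simp [h] at hτ
    · rw [h, mul_one] at hτ
      exact lt_of_le_of_ne (gelfand_nonneg τ hb) (right_ne_zero_of_mul hτ.ne').symm

end PHarmonic

theorem proposition3p8 {G : Type*} [Group G] [Infinite G] (S : Finset G)
    (hsymm : ∀ s ∈ S, s⁻¹ ∈ S) (hgen : Subgroup.closure (S : Set G) = ⊤)
    (p : ℝ) (hp : 1 < p) :
    TopologicalSpace.IsTopologicalBasis (PHarmonic.massiveFamily S p hp.le) := by
  refine TopologicalSpace.isTopologicalBasis_of_isOpen_of_nhds ?_ ?_
  · rintro _ ⟨A, u, -, hu, -, rfl⟩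
    exact (PHarmonic.isOpen_positiveSet hu.nonneg).preimage continuous_subtype_val
  · rintro x V hxV hV
    obtain ⟨U, hU, hUV⟩ := mem_nhds_subtype _ _ _ |>.1 (hV.mem_nhds hxV)
    obtain ⟨A, u, hA, hu, huA, hxu, hsub⟩ :=
      PHarmonic.exists_massive_subset hp hsymm hgen x.2 hU
    exact ⟨_, ⟨A, u, hA, hu, huA, rfl⟩, hxu, fun y hy => hUV (hsub ⟨hy, y.2⟩)⟩
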